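/- Let $k\ge 2$ and $n\ge k$ be fixed, and let $\varepsilon_1,\dots,\varepsilon_k\in(0,1)$ with $\sum_{i=1}^k\varepsilon_i=1$ be independent of $d$; put $\varepsilon_{(0)}=0$ and $\varepsilon_{(i)}=\sum_{m=1}^i\varepsilon_m$. For each dimension $d$ let $\Pi_1,\dots,\Pi_k$ be distributions on $\mathbb{R}^d$ (depending on $d$) with finite second moments, mean vectors $\mu_i$ and covariance matrices $\Sigma_i$, and let $\lambda_{i1}$ be the largest eigenvalue of $\Sigma_i$. Let $x_1,\dots,x_n$ be an independent sample from the mixture $\sum_{i=1}^k\varepsilon_i\Pi_i$: independently for each $j$, a latent class label, which does not depend on $d$, equals $m$ with probability $\varepsilon_m$, and given that the label is $m$ (written $x_j\in\Pi_m$) the vector $x_j$ has distribution $\Pi_m$. Let $\mu$ and $\Sigma$ be the mean vector and the covariance matrix of the mixture, let $\lambda_1\ge\dots\ge\lambda_d\ge 0$ be the eigenvalues of $\Sigma$ and $h_1,\dots,h_d$ a corresponding orthonormal basis of eigenvectors, and let $s_{ij}=h_i^T(x_j-\mu)$ be the $i$th true PC score of $x_j$. Put $\mu_{i,j}=\mu_i-\mu_j$,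 $\Delta_{i,j}=\|\mu_{i,j}\|^2$ and $\Delta_{\min}=\min_{1\le i<j\le k}\Delta_{i,j}$, where $\Delta_{\min}>0$ for all large $d$, and let the signs of the eigenvectors be chosen so that $h_i^T\mu_{i,i+1}\ge 0$ for $i=1,\dots,k-1$. Assume that, as $d\to\infty$, (Condition 1) $\displaystyle\frac{\max_{1\le i\le k}\lambda_{i1}}{\Delta_{\min}}\to 0$, and (Condition 5) the angle between $\mu_{i,i+1}$ and $\mu_{j,j+1}$ tends to $\pi/2$ and $\Delta_{j,j+1}/\Delta_{i,i+1}\to 0$, for all $1\le i<j\le k-1$. Then for all $i=1,\dots,k-1$ and $j=1,\dots,n$, as $d\to\infty$, $$\operatorname*{plim}_{d\to\infty}\frac{s_{ij}}{\lambda_i^{1/2}}=\begin{cases}0 & \text{when } i\ge 2 \text{ and } x_j\in\bigcup_{m=1}^{i-1}\Pi_m,\\ \sqrt{(1-\varepsilon_{(i)})/\{\varepsilon_i(1-\varepsilon_{(i-1)})\}} & \text{when } x_j\in\Pi_i,\\ -\sqrt{\varepsilon_i/\{(1-\varepsilon_{(i)})(1-\varepsilon_{(i-1)})\}} & \text{when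 } x_j\in\bigcup_{m=i+1}^k\Pi_m,\end{cases}$$ where for each class $m$ the convergence in probability is with respect to the conditional probability given $x_j\in\Pi_m$. -/

import Mathlib

open MeasureTheory ProbabilityTheory Filter Topology

noncomputable section

namespace MixturePCA

/-- The mean vector of a distribution on `ℝᵈ`. -/
def mean {d : ℕ} (ρ : Measure (EuclideanSpace ℝ (Fin d))) : EuclideanSpace ℝ (Fin d) :=
  ∫ x, x ∂ρ

/-- The covariance matrix of a distribution on `ℝᵈ`. -/
def covMatrix {d : ℕ} (ρ : Measure (EuclideanSpace ℝ (Fin d))) : Matrix (Fin d) (Fin d) ℝ :=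
  Matrix.of fun a b => covariance (fun x => x a) (fun x => x b) ρ

/-- The mixture distribution `∑ i, ε i • Π i`. -/
def mixture {k d : ℕ} (ε : Fin k → ℝ) (pop : Fin k → Measure (EuclideanSpace ℝ (Fin d))) :
    Measure (EuclideanSpace ℝ (Fin d)) :=
  ∑ i, ENNReal.ofReal (ε i) • pop i

/-- The largest eigenvalue of a real symmetric matrix, as the maximum of its (finite) spectrum. -/
def largestEigenvalue {d : ℕ} (S : Matrix (Fin d) (Fin d) ℝ) : ℝ :=
  sSup (spectrum ℝ S)

/-- `μ i - μ j`, the difference of the mean vectors of the classes `i` and `j`. -/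
def meanDiff {k d : ℕ} (pop : Fin k → Measure (EuclideanSpace ℝ (Fin d))) (i j : Fin k) :
    EuclideanSpace ℝ (Fin d) :=
  mean (pop i) - mean (pop j)

/-- `Δ i j = ‖μ i - μ j‖²`. -/
def gap {k d : ℕ} (pop : Fin k → Measure (EuclideanSpace ℝ (Fin d))) (i j : Fin k) : ℝ :=
  ‖meanDiff pop i j‖ ^ 2

/-- `Δ_min`, the minimum of `Δ i j` over `i < j`. -/
def gapMin {k d : ℕ} (pop : Fin k → Measure (EuclideanSpace ℝ (Fin d))) : ℝ :=
  ⨅ p : {p : Fin k × Fin k // p.1 < p.2}, gap pop p.1.1 p.1.2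

/-- The largest eigenvalues of the class covariance matrices are negligible relative to `Δ_min`
as `d → ∞`. The quotient presupposes `Δ_min > 0`, at least for all large `d`. -/
def NoiseCondition {k : ℕ} (pop : (d : ℕ) → Fin k → Measure (EuclideanSpace ℝ (Fin d))) : Prop :=
  (∀ᶠ d in atTop, 0 < gapMin (pop d)) ∧
  Tendsto (fun d => (⨆ i, largestEigenvalue (covMatrix (pop d i))) / gapMin (pop d)) atTop (𝓝 0)

/-- The consecutive mean differences are asymptotically orthogonal, and each has a squared length
that is negligible relative to those of the earlier ones. Classes are numbered from `0`. -/
def SeparationCondition {k : ℕ} (pop : (d : ℕ) → Fin k → Measure (EuclideanSpace ℝ (Fin d))) :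
    Prop :=
  ∀ (i j : ℕ) (hi : i + 1 < k) (hj : j + 1 < k), i < j →
    Tendsto (fun d => InnerProductGeometry.angle
        (meanDiff (pop d) ⟨i, Nat.lt_of_succ_lt hi⟩ ⟨i + 1, hi⟩)
        (meanDiff (pop d) ⟨j, Nat.lt_of_succ_lt hj⟩ ⟨j + 1, hj⟩)) atTop (𝓝 (Real.pi / 2)) ∧
    Tendsto (fun d => gap (pop d) ⟨j, Nat.lt_of_succ_lt hj⟩ ⟨j + 1, hj⟩ /
        gap (pop d) ⟨i, Nat.lt_of_succ_lt hi⟩ ⟨i + 1, hi⟩) atTop (𝓝 0)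

/-- `S = H Λ Hᵀ` with `Λ = diag (lam 0, …, lam (d - 1))`, `lam 0 ≥ ⋯ ≥ lam (d - 1)`, and
`H = (h 0, …, h (d - 1))` orthogonal. Only the indices `a < d` are meaningful. -/
structure IsEigenDecomposition {d : ℕ} (S : Matrix (Fin d) (Fin d) ℝ) (lam : ℕ → ℝ)
    (h : ℕ → EuclideanSpace ℝ (Fin d)) : Prop where
  orthonormal : Orthonormal ℝ (fun a : Fin d => h a)
  antitone : Antitone (fun a : Fin d => lam a)
  eigen : ∀ a : Fin d, S.mulVec (h a).ofLp = lam a • (h a).ofLp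

/-- `x 0, …, x (n - 1)` is an independent sample from the mixture, `label j` being the latent class
of `x j`: the class `m` is drawn with probability `ε m`, and given that class the law of `x j`
is `pop m`. -/
structure IsMixtureSample {Ω : Type*} [MeasurableSpace Ω] {k n d : ℕ} (P : Measure Ω)
    (ε : Fin k → ℝ) (pop : Fin k → Measure (EuclideanSpace ℝ (Fin d)))
    (label : Fin n → Ω → Fin k) (x : Fin n → Ω → EuclideanSpace ℝ (Fin d)) : Prop where
  measurable_label : ∀ j, Measurable (label j)
  measurable_sample : ∀ j, Measurable (x j)
  prob_label : ∀ j m, P (label j ⁻¹' {m}) = ENNReal.ofReal (ε m)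
  law_sample : ∀ j m, (cond P (label j ⁻¹' {m})).map (x j) = pop m
  indep : iIndepFun (fun j ω => (label j ω, x j ω)) P

/-- The sum of the first `i` mixing proportions. -/
def cumProp {k : ℕ} (ε : Fin k → ℝ) (i : ℕ) : ℝ :=
  ∑ m : Fin k, if (m : ℕ) < i then ε m else 0

/-- The limit of the normalized PC score with index `i` for a sample from class `m`. Both are
numbered from `0`, so `cumProp ε (i + 1)` is the sum of the proportions up to and including
that of class `i`. -/
def scoreLimit {k : ℕ} (ε : Fin k → ℝ) (i m : Fin k) : ℝ :=
  if m < i then 0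
  else if m = i then √((1 - cumProp ε (i + 1)) / (ε i * (1 - cumProp ε i)))
  else -√(ε i / ((1 - cumProp ε (i + 1)) * (1 - cumProp ε i)))

end MixturePCA

end

namespace MixturePCA

/-! ### Tail sums over `Fin k` -/

/-! Put `a d i m = ⟨h d i, μ_m - μ⟩ / √(lam d i)`. Given class `m`, the normalized score has
conditional mean `a d i m` and variance at most `N / lam d i`, where `N` is the largest eigenvalue
among the class covariances. By Chebyshev it suffices that `N / lam d i → 0` and `a d i m →
scoreLimit ε i m`.

The eigenvalue is bounded below by a min-max argument: `i + 1` nearly orthogonal mean differences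
span a nonzero vector orthogonal to the first `i` eigenvectors, and the mixture variance along it is
at least of order `Δ i (i+1)` (`mul_gap_le_eigenvalue`). Hence `N / lam d i → 0`, and the rows `a d
i` become orthonormal for the weights `ε` (`abs_gram_sub_le`). Cauchy–Schwarz and the decay of later
gaps make row `i` asymptotically constant on the classes after `i`.

These relations, with weighted mean zero and the sign choice, determine the limit by a Gram–Schmidt
induction (`tendsto_scoreLimit_of_gram`). No convergence of the eigenvectors is needed. -/

lemma sum_ite_le_eq_add {k : ℕ} (f : Fin k → ℝ) (j : Fin k) :
    (∑ m : Fin k, if (j : ℕ) ≤ m then f m else 0)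
      = f j + ∑ m : Fin k, if (j : ℕ) + 1 ≤ m then f m else 0 := by
  have : ∀ m : Fin k, (if (j : ℕ) ≤ m then f m else 0)
      = (if m = j then f m else 0) + if (j : ℕ) + 1 ≤ m then f m else 0 := by
    intro m
    rcases lt_trichotomy (m : ℕ) j with hm | hm | hm
    · have : m ≠ j := fun e => by simp [e] at hm
      simp [this, hm.not_ge, (show ¬ (j : ℕ) + 1 ≤ m by omega)]
    · have : m = j := Fin.ext hm
      subst this; simp
    · have : m ≠ j := fun e => by simp [e] at hm
      simp [this, hm.le, (show (j : ℕ) + 1 ≤ m by omega)]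
  simp_rw [this, Finset.sum_add_distrib]
  simp

lemma one_sub_cumProp {k : ℕ} {ε : Fin k → ℝ} (hsum : ∑ m, ε m = 1) (i : ℕ) :
    1 - cumProp ε i = ∑ m : Fin k, if i ≤ (m : ℕ) then ε m else 0 := by
  rw [← hsum, cumProp, ← Finset.sum_sub_distrib]
  refine Finset.sum_congr rfl fun m _ => ?_
  rcases lt_or_ge (m : ℕ) i with h | h
  · simp [h, h.not_ge]
  · simp [h, h.not_gt]

lemma one_sub_cumProp_pos {k : ℕ} {ε : Fin k → ℝ} (hε : ∀ m, 0 < ε m) (hsum : ∑ m, ε m = 1)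
    {i : ℕ} (hi : i < k) : 0 < 1 - cumProp ε i := by
  rw [one_sub_cumProp hsum]
  refine Finset.sum_pos' (fun m _ => ?_) ⟨⟨i, hi⟩, Finset.mem_univ _, by simpa using hε _⟩
  split_ifs
  · exact (hε m).le
  · rfl

lemma one_sub_cumProp_eq_add {k : ℕ} {ε : Fin k → ℝ} (hsum : ∑ m, ε m = 1) (i : Fin k) :
    1 - cumProp ε i = ε i + (1 - cumProp ε (i + 1)) := by
  rw [one_sub_cumProp hsum, one_sub_cumProp hsum, sum_ite_le_eq_add]

/-- A limiting row takes only three values, so pairing with it sees only the entry at `j` and the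
tail beyond `j`. This allows the entries to be eliminated one at a time. -/
lemma sum_mul_scoreLimit {k : ℕ} (ε f : Fin k → ℝ) (j : Fin k) :
    ∑ m, f m * scoreLimit ε j m
      = √((1 - cumProp ε (j + 1)) / (ε j * (1 - cumProp ε j))) * f j
        - √(ε j / ((1 - cumProp ε (j + 1)) * (1 - cumProp ε j)))
          * ∑ m : Fin k, if (j : ℕ) + 1 ≤ m then f m else 0 := by
  have : ∀ m : Fin k, f m * scoreLimit ε j m
      = (if m = j then √((1 - cumProp ε (j + 1)) / (ε j * (1 - cumProp ε j))) * f m else 0)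
        - √(ε j / ((1 - cumProp ε (j + 1)) * (1 - cumProp ε j)))
          * if (j : ℕ) + 1 ≤ m then f m else 0 := by
    intro m
    unfold scoreLimit
    rcases lt_trichotomy m j with hm | hm | hm
    · have h' : ¬ (j : ℕ) + 1 ≤ m := by have := Fin.lt_def.1 hm; omega
      simp only [hm, hm.ne, h', if_true, if_false]; ring
    · subst hm; simp; ring
    · have h' : (j : ℕ) + 1 ≤ m := by have := Fin.lt_def.1 hm; omega
      simp only [hm.not_gt, hm.ne', h', if_true, if_false]; ring
  simp_rw [this, Finset.sum_sub_distrib, ← Finset.mul_sum]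
  simp

/-! ### Asymptotically orthonormal functions that are asymptotically constant past the diagonal -/

lemma tendsto_of_sq_tendsto_of_eventually_ge {ι : Type*} {l : Filter ι} {x e : ι → ℝ} {c : ℝ}
    (hx : Tendsto (fun d => x d ^ 2) l (𝓝 c)) (he : Tendsto e l (𝓝 0))
    (hxe : ∀ᶠ d in l, e d ≤ x d) : Tendsto x l (𝓝 (√c)) := by
  have habs : Tendsto (fun d => |x d|) l (𝓝 (√c)) := by
    simpa [Real.sqrt_sq_eq_abs] using hx.sqrt
  -- The negative part is squeezed between `min e 0` and `0`, and `x = |x| + 2 * min x 0`.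
  have hmin : Tendsto (fun d => min (x d) 0) l (𝓝 0) := by
    refine tendsto_of_tendsto_of_tendsto_of_le_of_le' (g := fun d => min (e d) 0)
      (by simpa using he.min (tendsto_const_nhds (x := (0 : ℝ)))) tendsto_const_nhds ?_
      (Eventually.of_forall fun d => min_le_right _ _)
    filter_upwards [hxe] with d hd using min_le_min_right _ hd
  have : Tendsto (fun d => |x d| + 2 * min (x d) 0) l (𝓝 (√c + 2 * 0)) :=
    habs.add (hmin.const_mul 2)
  rw [mul_zero, add_zero] at this
  refine this.congr fun d => ?_
  rcases le_total (x d) 0 with h | h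
  · rw [abs_of_nonpos h, min_eq_left h]; ring
  · rw [abs_of_nonneg h, min_eq_right h]; ring

lemma isBoundedUnder_of_tendsto_sum_mul_sq {ι α : Type*} [Fintype α] {l : Filter ι} {ε : α → ℝ}
    (hε : ∀ m, 0 < ε m) {a : ι → α → ℝ} {c : ℝ}
    (ha : Tendsto (fun d => ∑ m, ε m * (a d m * a d m)) l (𝓝 c)) (m : α) :
    IsBoundedUnder (· ≤ ·) l fun d => ‖a d m‖ := by
  refine isBoundedUnder_of_eventually_le (a := √((c + 1) / ε m)) ?_
  filter_upwards [ha.eventually (gt_mem_nhds (lt_add_one c))] with d hd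
  rw [Real.norm_eq_abs, ← Real.sqrt_sq_eq_abs]
  refine Real.sqrt_le_sqrt ?_
  rw [le_div_iff₀ (hε m)]
  have : ε m * (a d m * a d m) ≤ ∑ m, ε m * (a d m * a d m) :=
    Finset.single_le_sum (f := fun m => ε m * (a d m * a d m))
      (fun m _ => mul_nonneg (hε m).le (mul_self_nonneg _)) (Finset.mem_univ m)
  nlinarith

/-- Orthogonality to the earlier rows, whose limits are known by induction, kills the entries before
the diagonal. Two unknowns remain, the diagonal value and the common value after it; mean zero and
unit norm fix them up to a sign. -/
theorem tendsto_scoreLimit_of_gram {ι : Type*} {l : Filter ι} {k : ℕ} {ε : Fin k → ℝ}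
    (hε : ∀ m, 0 < ε m) (hsum : ∑ m, ε m = 1) {a : ι → Fin k → Fin k → ℝ}
    (hmean : ∀ d i, ∑ m, ε m * a d i m = 0)
    (hgram : ∀ i j : Fin k, (i : ℕ) + 1 < k → (j : ℕ) + 1 < k →
      Tendsto (fun d => ∑ m, ε m * (a d i m * a d j m)) l (𝓝 (if i = j then 1 else 0)))
    (hconst : ∀ (i : Fin k) (m : ℕ) (hm : m + 1 < k), (i : ℕ) < m →
      Tendsto (fun d => a d i ⟨m, Nat.lt_of_succ_lt hm⟩ - a d i ⟨m + 1, hm⟩) l (𝓝 0))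
    (hsign : ∀ (i : ℕ) (hi : i + 1 < k), ∀ᶠ d in l,
      a d ⟨i, Nat.lt_of_succ_lt hi⟩ ⟨i + 1, hi⟩
        ≤ a d ⟨i, Nat.lt_of_succ_lt hi⟩ ⟨i, Nat.lt_of_succ_lt hi⟩)
    (i : Fin k) (hi : (i : ℕ) + 1 < k) (m : Fin k) :
    Tendsto (fun d => a d i m) l (𝓝 (scoreLimit ε i m)) := by
  induction i using WellFoundedLT.induction generalizing m with
  | ind i ih =>
  have hbdd : ∀ m, IsBoundedUnder (· ≤ ·) l fun d => ‖a d i m‖ :=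
    isBoundedUnder_of_tendsto_sum_mul_sq hε (by simpa using hgram i i hi hi)
  have hR : ∀ {j : ℕ}, j < k → 0 < 1 - cumProp ε j := fun hj => one_sub_cumProp_pos hε hsum hj
  -- the tail sums and the values before the diagonal vanish in the limit
  have htail : ∀ j : ℕ, j ≤ i →
      Tendsto (fun d => ∑ m : Fin k, if j ≤ (m : ℕ) then ε m * a d i m else 0) l (𝓝 0) ∧
      ∀ m : Fin k, (m : ℕ) < j → Tendsto (fun d => a d i m) l (𝓝 0) := by
    intro j
    induction j with
    | zero => simp [hmean, tendsto_const_nhds]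
    | succ j ihj =>
      intro hj
      obtain ⟨h1, h2⟩ := ihj (by omega)
      have hjk : j < k := by omega
      have hj1 : j + 1 < k := by omega
      let j' : Fin k := ⟨j, hjk⟩
      have hji : j' < i := Fin.lt_def.2 (by simp only [j']; omega)
      set α := √((1 - cumProp ε (j + 1)) / (ε j' * (1 - cumProp ε j))) with hα
      set β := √(ε j' / ((1 - cumProp ε (j + 1)) * (1 - cumProp ε j))) with hβ
      have hαpos : 0 < α :=
        Real.sqrt_pos.2 (div_pos (hR hj1) (mul_pos (hε _) (hR hjk)))
      have hβpos : 0 ≤ β := Real.sqrt_nonneg _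
      have hlim : Tendsto (fun d => ∑ m, (ε m * a d i m) * scoreLimit ε j' m) l (𝓝 0) := by
        -- Row `j` may be replaced by its limit because row `i` stays bounded.
        have e1 : Tendsto (fun d => ∑ m, ε m * ((a d j' m - scoreLimit ε j' m) * a d i m))
            l (𝓝 (∑ m : Fin k, ε m * 0)) := by
          refine tendsto_finsetSum _ fun m _ => Tendsto.const_mul _ ?_
          refine Tendsto.zero_mul_isBoundedUnder_le ?_ (hbdd m)
          simpa using (ih j' hji hj1 m).sub_const (scoreLimit ε j' m)
        have e2 := (hgram i j' hi hj1).sub e1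
        rw [if_neg hji.ne'] at e2
        simp only [mul_zero, Finset.sum_const_zero, sub_zero] at e2
        refine e2.congr fun d => ?_
        rw [← Finset.sum_sub_distrib]
        exact Finset.sum_congr rfl fun m _ => by ring
      -- Orthogonality gives `α * f j - β * T (j+1) → 0` for `f m = ε m * a d i m` with tail sums
      -- `T`. Adding `β * T j → 0` cancels the later tail and leaves `(α + β) * f j`.
      have hval : Tendsto (fun d => a d i j') l (𝓝 0) := by
        have e := (hlim.add (h1.const_mul β)).const_mul (((α + β) * ε j')⁻¹)
        simp only [mul_zero, add_zero] at e
        refine e.congr fun d => ?_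
        rw [sum_mul_scoreLimit, sum_ite_le_eq_add (fun m => ε m * a d i m) j']
        have : (α + β) * ε j' ≠ 0 := (mul_pos (by positivity) (hε _)).ne'
        rw [inv_mul_eq_iff_eq_mul₀ this]
        simp only [j', ← hα, ← hβ]
        ring
      refine ⟨?_, fun m hm => ?_⟩
      · have e := h1.sub (hval.const_mul (ε j'))
        rw [mul_zero, sub_zero] at e
        refine e.congr fun d => ?_
        rw [sum_ite_le_eq_add (fun m => ε m * a d i m) j']
        ring
      · rcases Nat.lt_succ_iff_lt_or_eq.1 hm with h | h
        · exact h2 m h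
        · have : m = j' := Fin.ext h
          exact this ▸ hval
  obtain ⟨hT, hbefore⟩ := htail i le_rfl
  let i' : Fin k := ⟨i + 1, hi⟩
  have hafter : ∀ m : Fin k, (i : ℕ) + 1 ≤ m →
      Tendsto (fun d => a d i m - a d i i') l (𝓝 0) := by
    rintro ⟨m, hm⟩ him
    simp only at him
    induction m, him using Nat.le_induction with
    | base => simp [i', tendsto_const_nhds]
    | succ m him ihm =>
      have e := (ihm (by omega)).sub (hconst i m hm (by omega))
      rw [sub_zero] at e
      exact e.congr fun d => by ring
  set R := 1 - cumProp ε (i + 1) with hRdef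
  have hRpos : 0 < R := hR hi
  have hεi := hε i
  have hRi : 1 - cumProp ε i = ε i + R := one_sub_cumProp_eq_add hsum i
  have hsumR : R = ∑ m : Fin k, if (i : ℕ) + 1 ≤ m then ε m else 0 := one_sub_cumProp hsum _
  have hlin : Tendsto (fun d => ε i * a d i i + R * a d i i') l (𝓝 0) := by
    have e1 : Tendsto (fun d => ∑ m : Fin k,
        if (i : ℕ) + 1 ≤ m then ε m * (a d i m - a d i i') else 0) l
        (𝓝 (∑ m : Fin k, if (i : ℕ) + 1 ≤ m then ε m * 0 else 0)) := by
      refine tendsto_finsetSum _ fun m _ => ?_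
      split_ifs with h
      · exact (hafter m h).const_mul _
      · exact tendsto_const_nhds
    have e2 := hT.sub e1
    simp only [mul_zero, ite_self, Finset.sum_const_zero, sub_zero] at e2
    refine e2.congr fun d => ?_
    rw [sum_ite_le_eq_add (fun m => ε m * a d i m), add_sub_assoc, ← Finset.sum_sub_distrib,
      hsumR, Finset.sum_mul]
    congr 1
    refine Finset.sum_congr rfl fun m _ => ?_
    split_ifs <;> ring
  have hquad : Tendsto (fun d => ε i * a d i i ^ 2 + R * a d i i' ^ 2) l (𝓝 1) := by
    -- Entries before the diagonal vanish; those after it are compared with the entry at `i'`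
    -- through `x² - y² = (x - y) * x + (x - y) * y`.
    have e1 : Tendsto (fun d => ∑ m : Fin k, (if m = i then 0 else ε m *
        (a d i m * a d i m - if (i : ℕ) + 1 ≤ m then a d i i' * a d i i' else 0))) l
        (𝓝 (∑ m : Fin k, 0)) := by
      refine tendsto_finsetSum _ fun m _ => ?_
      split_ifs with h1 h2
      · exact tendsto_const_nhds
      · have e := ((hafter m h2).zero_mul_isBoundedUnder_le (hbdd m)).add
          ((hafter m h2).zero_mul_isBoundedUnder_le (hbdd i'))
        have e' := e.const_mul (ε m)
        rw [add_zero, mul_zero] at e'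
        exact e'.congr fun d => by ring
      · have hm : (m : ℕ) < i := by
          have : (m : ℕ) ≠ i := fun h => h1 (Fin.ext h)
          omega
        simpa using ((hbefore m hm).mul (hbefore m hm)).const_mul (ε m)
    have e2 := (hgram i i hi hi).sub e1
    simp only [if_true, Finset.sum_const_zero, sub_zero] at e2
    refine e2.congr fun d => ?_
    have hi0 : ε i * a d i i ^ 2 = ∑ m : Fin k, if m = i then ε m * a d i m ^ 2 else 0 := by simp
    rw [hi0, hsumR, Finset.sum_mul, ← Finset.sum_sub_distrib, ← Finset.sum_add_distrib]
    refine Finset.sum_congr rfl fun m _ => ?_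
    by_cases h1 : m = i
    · subst h1; simp [sq]
    · by_cases h2 : (i : ℕ) + 1 ≤ m
      · simp only [h1, h2, if_true, if_false]; ring
      · simp only [h1, h2, if_false]; ring
  have hsq : Tendsto (fun d => a d i i ^ 2) l (𝓝 (R / (ε i * (1 - cumProp ε i)))) := by
    have hb : IsBoundedUnder (· ≤ ·) l fun d => ‖a d i i'‖ := hbdd i'
    -- With `p`, `q` the entries at `i`, `i'` and `L = ε i * p + R * q`, the unknown `q` is
    -- eliminated by `R * (ε i * p² + R * q²) - R * L * q + ε i * L * p = ε i * (ε i + R) * p²`.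
    have e1 := ((hlin.zero_mul_isBoundedUnder_le hb).const_mul R).sub
      ((hlin.zero_mul_isBoundedUnder_le (hbdd i)).const_mul (ε i))
    have e2 := ((hquad.const_mul R).sub e1).div_const (ε i * (1 - cumProp ε i))
    simp only [mul_zero, sub_zero, mul_one] at e2
    refine e2.congr fun d => ?_
    rw [hRi]
    field_simp
    ring
  have hdiag : Tendsto (fun d => a d i i) l (𝓝 (√(R / (ε i * (1 - cumProp ε i))))) := by
    have he := hlin.div_const (ε i + R)
    rw [zero_div] at he
    -- Since `q ≤ p`, one has `p ≥ L / (ε i + R) → 0`, which selects the nonnegative root.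
    refine tendsto_of_sq_tendsto_of_eventually_ge hsq he ?_
    filter_upwards [hsign i hi] with d hd
    rw [div_le_iff₀ (by positivity)]
    have : R * a d i i' ≤ R * a d i i := mul_le_mul_of_nonneg_left hd hRpos.le
    linarith
  unfold scoreLimit
  split_ifs with h1 h2
  · exact hbefore m h1
  · subst h2; exact hdiag
  · have him : (i : ℕ) + 1 ≤ m := by
      have : (m : ℕ) ≠ i := fun h => h2 (Fin.ext h)
      have : ¬ (m : ℕ) < i := h1
      omega
    have e := (hafter m him).add ((hlin.sub (hdiag.const_mul (ε i))).div_const R)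
    have hval : 0 + (0 - ε i * √(R / (ε i * (1 - cumProp ε i)))) / R
        = -√(ε i / (R * (1 - cumProp ε i))) := by
      have hP : 0 < 1 - cumProp ε i := by rw [hRi]; positivity
      have : ε i / (R * (1 - cumProp ε i))
          = (ε i / R) ^ 2 * (R / (ε i * (1 - cumProp ε i))) := by
        field_simp
      rw [this, Real.sqrt_mul (by positivity), Real.sqrt_sq (by positivity)]
      ring
    rw [hval] at e
    refine e.congr fun d => ?_
    field_simp
    ring

/-! ### Covariances of linear functionals -/

section Covariance

variable {d : ℕ} {ρ : Measure (EuclideanSpace ℝ (Fin d))}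

lemma memLp_inner (hρ : MemLp (fun x => x) 2 ρ) (u : EuclideanSpace ℝ (Fin d)) :
    MemLp (fun x => inner ℝ u x) 2 ρ :=
  hρ.const_inner u

lemma inner_mean [IsFiniteMeasure ρ] (hρ : MemLp (fun x => x) 2 ρ)
    (u : EuclideanSpace ℝ (Fin d)) : inner ℝ u (mean ρ) = ∫ x, inner ℝ u x ∂ρ :=
  (integral_inner (hρ.integrable (by norm_num)) u).symm

lemma dotProduct_covMatrix_mulVec [IsFiniteMeasure ρ] (hρ : MemLp (fun x => x) 2 ρ)
    (u v : EuclideanSpace ℝ (Fin d)) :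
    u.ofLp ⬝ᵥ (covMatrix ρ).mulVec v.ofLp
      = cov[fun x => inner ℝ u x, fun x => inner ℝ v x; ρ] := by
  have hcoord : ∀ a : Fin d, MemLp (fun x : EuclideanSpace ℝ (Fin d) => x a) 2 ρ := fun a => by
    simpa [PiLp.inner_apply] using memLp_inner hρ (EuclideanSpace.single a 1)
  have hin : ∀ w : EuclideanSpace ℝ (Fin d), (fun x : EuclideanSpace ℝ (Fin d) => inner ℝ w x)
      = fun x => ∑ a, w a * x a := by
    intro w; ext x; simp [PiLp.inner_apply, mul_comm]
  rw [hin u, hin v, covariance_fun_sum_fun_sum (fun a => (hcoord a).const_mul _)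
    (fun a => (hcoord a).const_mul _)]
  simp only [dotProduct, Matrix.mulVec, covMatrix, Matrix.of_apply, Finset.mul_sum,
    covariance_const_mul_left, covariance_const_mul_right]
  refine Finset.sum_congr rfl fun a _ => Finset.sum_congr rfl fun b _ => by ring

lemma isHermitian_covMatrix : (covMatrix ρ).IsHermitian := by
  ext a b
  simp [covMatrix, covariance_comm]

/-- The spectrum of `largestEigenvalue S • 1 - S` is the reflected spectrum of `S`, hence
nonnegative. -/
lemma dotProduct_mulVec_le_largestEigenvalue {S : Matrix (Fin d) (Fin d) ℝ} (hS : S.IsHermitian)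
    (u : EuclideanSpace ℝ (Fin d)) :
    u.ofLp ⬝ᵥ S.mulVec u.ofLp ≤ largestEigenvalue S * ‖u‖ ^ 2 := by
  have hpsd : (algebraMap ℝ (Matrix (Fin d) (Fin d) ℝ) (largestEigenvalue S) - S).PosSemidef := by
    rw [Matrix.posSemidef_iff_isHermitian_and_spectrum_nonneg]
    refine ⟨?_, ?_⟩
    · refine Matrix.IsHermitian.sub ?_ hS
      rw [Matrix.algebraMap_eq_diagonal]
      exact Matrix.isHermitian_diagonal _
    · rw [← spectrum.singleton_sub_eq]
      rintro _ ⟨_, rfl, t, ht, rfl⟩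
      exact sub_nonneg.2 (le_csSup (Matrix.finite_real_spectrum (A := S)).bddAbove ht)
  have := hpsd.dotProduct_mulVec_nonneg u.ofLp
  rw [Matrix.sub_mulVec, dotProduct_sub, Algebra.algebraMap_eq_smul_one, Matrix.smul_mulVec,
    Matrix.one_mulVec, dotProduct_smul] at this
  have hn : u.ofLp ⬝ᵥ u.ofLp = ‖u‖ ^ 2 := by
    rw [EuclideanSpace.norm_sq_eq]
    simp [dotProduct, sq]
  simp only [star_trivial, hn, smul_eq_mul] at this
  linarith

lemma variance_inner_le [IsFiniteMeasure ρ] (hρ : MemLp (fun x => x) 2 ρ)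
    (u : EuclideanSpace ℝ (Fin d)) :
    Var[fun x => inner ℝ u x; ρ] ≤ largestEigenvalue (covMatrix ρ) * ‖u‖ ^ 2 := by
  rw [← covariance_self (memLp_inner hρ u).aemeasurable, ← dotProduct_covMatrix_mulVec hρ]
  exact dotProduct_mulVec_le_largestEigenvalue isHermitian_covMatrix u

end Covariance

/-- Both `Var[X + Y]` and `Var[X - Y]` are nonnegative; a factor of two is given away. -/
lemma abs_covariance_le_add {Ω : Type*} [MeasurableSpace Ω] {μ : Measure Ω} [IsFiniteMeasure μ]
    {X Y : Ω → ℝ} (hX : MemLp X 2 μ) (hY : MemLp Y 2 μ) :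
    |cov[X, Y; μ]| ≤ Var[X; μ] + Var[Y; μ] := by
  have h1 := variance_nonneg (X + Y) μ
  have h2 := variance_nonneg (X - Y) μ
  have h3 := variance_nonneg X μ
  have h4 := variance_nonneg Y μ
  rw [variance_add hX hY] at h1
  rw [variance_sub hX hY] at h2
  rw [abs_le]
  constructor <;> linarith

/-! ### Mixtures -/

section Mixture

variable {k d : ℕ} {ε : Fin k → ℝ} {pop : Fin k → Measure (EuclideanSpace ℝ (Fin d))}

lemma integral_mixture (hε : ∀ m, 0 ≤ ε m) {E : Type*} [NormedAddCommGroup E] [NormedSpace ℝ E]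
    {f : EuclideanSpace ℝ (Fin d) → E} (hf : ∀ m, Integrable f (pop m)) :
    ∫ x, f x ∂(mixture ε pop) = ∑ m, ε m • ∫ x, f x ∂(pop m) := by
  rw [mixture, integral_finsetSum_measure fun m _ => (hf m).smul_measure ENNReal.ofReal_ne_top]
  simp [integral_smul_measure, ENNReal.toReal_ofReal (hε _)]

lemma memLp_mixture (hpop : ∀ m, MemLp (fun x => x) 2 (pop m)) :
    MemLp (fun x => x) 2 (mixture ε pop) := by
  refine (memLp_two_iff_integrable_sq_norm aestronglyMeasurable_id).2 ?_
  rw [mixture, integrable_finsetSum_measure]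
  exact fun m _ => ((hpop m).integrable_norm_pow two_ne_zero).smul_measure ENNReal.ofReal_ne_top

lemma isProbabilityMeasure_mixture (hε : ∀ m, 0 ≤ ε m) (hsum : ∑ m, ε m = 1)
    [∀ m, IsProbabilityMeasure (pop m)] : IsProbabilityMeasure (mixture ε pop) := by
  constructor
  simp only [mixture, Measure.coe_finsetSum, Finset.sum_apply, Measure.smul_apply, measure_univ,
    smul_eq_mul, mul_one]
  rw [← ENNReal.ofReal_sum_of_nonneg fun m _ => hε m, hsum, ENNReal.ofReal_one]

lemma mean_mixture (hε : ∀ m, 0 ≤ ε m) [∀ m, IsProbabilityMeasure (pop m)]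
    (hpop : ∀ m, MemLp (fun x => x) 2 (pop m)) :
    mean (mixture ε pop) = ∑ m, ε m • mean (pop m) :=
  integral_mixture hε fun m => (hpop m).integrable (by norm_num)

lemma sum_mul_inner_mean_sub (hε : ∀ m, 0 ≤ ε m) (hsum : ∑ m, ε m = 1)
    [∀ m, IsProbabilityMeasure (pop m)] (hpop : ∀ m, MemLp (fun x => x) 2 (pop m))
    (u : EuclideanSpace ℝ (Fin d)) :
    ∑ m, ε m * inner ℝ u (mean (pop m) - mean (mixture ε pop)) = 0 := by
  simp_rw [inner_sub_right, mul_sub, Finset.sum_sub_distrib, ← Finset.sum_mul, hsum, one_mul,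
    mean_mixture hε hpop, inner_sum, inner_smul_right]
  simp

/-- Law of total covariance: within-class plus between-class part. The cross terms drop out because
the centred class means average to zero. -/
lemma covariance_mixture (hε : ∀ m, 0 ≤ ε m) (hsum : ∑ m, ε m = 1)
    [∀ m, IsProbabilityMeasure (pop m)] (hpop : ∀ m, MemLp (fun x => x) 2 (pop m))
    (u v : EuclideanSpace ℝ (Fin d)) :
    cov[fun x => inner ℝ u x, fun x => inner ℝ v x; mixture ε pop]
      = ∑ m, ε m * (cov[fun x => inner ℝ u x, fun x => inner ℝ v x; pop m]
        + inner ℝ u (mean (pop m) - mean (mixture ε pop))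
          * inner ℝ v (mean (pop m) - mean (mixture ε pop))) := by
  have := isProbabilityMeasure_mixture (pop := pop) hε hsum
  have hu := fun m => memLp_inner (hpop m) u
  have hv := fun m => memLp_inner (hpop m) v
  have hmix : MemLp (fun x => x) 2 (mixture ε pop) := memLp_mixture hpop
  have hu0 := sum_mul_inner_mean_sub hε hsum hpop u
  have hv0 := sum_mul_inner_mean_sub hε hsum hpop v
  rw [covariance_eq_sub (memLp_inner hmix u) (memLp_inner hmix v)]
  simp_rw [fun m => covariance_eq_sub (hu m) (hv m)]
  simp only [Pi.mul_apply]
  rw [integral_mixture (f := fun x => inner ℝ u x * inner ℝ v x) hε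
    fun m => (hu m).integrable_mul (hv m)]
  simp only [← inner_mean hmix, fun m => (inner_mean (hpop m) u).symm,
    fun m => (inner_mean (hpop m) v).symm, smul_eq_mul]
  simp only [inner_sub_right] at hu0 hv0 ⊢
  set A := inner ℝ u (mean (mixture ε pop))
  set B := inner ℝ v (mean (mixture ε pop))
  have key : ∀ m, ε m * (∫ x, inner ℝ u x * inner ℝ v x ∂pop m
      - inner ℝ u (mean (pop m)) * inner ℝ v (mean (pop m))
      + (inner ℝ u (mean (pop m)) - A) * (inner ℝ v (mean (pop m)) - B))
      = ε m * ∫ x, inner ℝ u x * inner ℝ v x ∂pop m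
        - ε m * (inner ℝ u (mean (pop m)) - A) * B - ε m * (inner ℝ v (mean (pop m)) - B) * A
        - ε m * (A * B) := fun m => by ring
  simp_rw [key, Finset.sum_sub_distrib, ← Finset.sum_mul, hu0, hv0, hsum]
  simp

end Mixture

/-! ### Eigen-decompositions -/

section EigenDecomposition

variable {d : ℕ} {S : Matrix (Fin d) (Fin d) ℝ} {lam : ℕ → ℝ} {h : ℕ → EuclideanSpace ℝ (Fin d)}

lemma dotProduct_eq_inner (u v : EuclideanSpace ℝ (Fin d)) : u.ofLp ⬝ᵥ v.ofLp = inner ℝ u v := by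
  simp [PiLp.inner_apply, dotProduct, mul_comm]

lemma IsEigenDecomposition.norm_eq_one (hdec : IsEigenDecomposition S lam h) {i : ℕ}
    (hi : i < d) : ‖h i‖ = 1 :=
  hdec.orthonormal.1 ⟨i, hi⟩

lemma IsEigenDecomposition.dotProduct_mulVec (hdec : IsEigenDecomposition S lam h) {i j : ℕ}
    (hi : i < d) (hj : j < d) :
    (h i).ofLp ⬝ᵥ S.mulVec (h j).ofLp = if i = j then lam i else 0 := by
  have := hdec.eigen ⟨j, hj⟩
  simp only at this
  rw [this, dotProduct_smul, dotProduct_eq_inner,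
    orthonormal_iff_ite.1 hdec.orthonormal ⟨i, hi⟩ ⟨j, hj⟩]
  by_cases hij : i = j
  · subst hij; simp
  · simp [hij]

/-- One half of Courant–Fischer: in the eigenbasis the first `i` coordinates of `u` vanish, and the
remaining eigenvalues are at most `lam i`. -/
lemma IsEigenDecomposition.dotProduct_mulVec_le (hdec : IsEigenDecomposition S lam h) {i : ℕ}
    (hi : i < d) {u : EuclideanSpace ℝ (Fin d)} (hu : ∀ a < i, inner ℝ (h a) u = 0) :
    u.ofLp ⬝ᵥ S.mulVec u.ofLp ≤ lam i * ‖u‖ ^ 2 := by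
  have : Nonempty (Fin d) := ⟨⟨i, hi⟩⟩
  let b : OrthonormalBasis (Fin d) ℝ (EuclideanSpace ℝ (Fin d)) :=
    (basisOfOrthonormalOfCardEqFinrank hdec.orthonormal (by simp)).toOrthonormalBasis
      (by simpa using hdec.orthonormal)
  have hb : ∀ a, b a = h a := by simp [b]
  have hexp : u.ofLp = ∑ a : Fin d, inner ℝ (h a) u • (h a).ofLp := by
    conv_lhs => rw [← b.sum_repr' u]
    simp [hb]
  have hquad : u.ofLp ⬝ᵥ S.mulVec u.ofLp = ∑ a : Fin d, lam a * inner ℝ (h a) u ^ 2 := by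
    conv_lhs => rw [hexp, Matrix.mulVec_sum, ← hexp, dotProduct_sum]
    refine Finset.sum_congr rfl fun a _ => ?_
    rw [Matrix.mulVec_smul, hdec.eigen a, dotProduct_smul, dotProduct_smul, dotProduct_eq_inner,
      real_inner_comm]
    simp only [smul_eq_mul]; ring
  have hnorm : ‖u‖ ^ 2 = ∑ a : Fin d, inner ℝ (h a) u ^ 2 := by
    rw [← b.sum_sq_norm_inner_right u]
    simp [hb]
  rw [hquad, hnorm, Finset.mul_sum]
  refine Finset.sum_le_sum fun a _ => ?_
  rcases lt_or_ge (a : ℕ) i with ha | ha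
  · simp [hu a ha]
  · exact mul_le_mul_of_nonneg_right (hdec.antitone (show (⟨i, hi⟩ : Fin d) ≤ a from ha))
      (sq_nonneg _)

end EigenDecomposition

/-! ### Nearly orthonormal families -/

section NearlyOrthonormal

variable {E : Type*} [NormedAddCommGroup E] [InnerProductSpace ℝ E]

/-- There are `i` linear conditions on `i + 1` coefficients. -/
lemma exists_combination_orthogonal {i : ℕ} (h : Fin i → E) (e : Fin (i + 1) → E) :
    ∃ t : Fin (i + 1) → ℝ, t ≠ 0 ∧ ∀ a, inner ℝ (h a) (∑ j, t j • e j) = 0 := by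
  let f : (Fin (i + 1) → ℝ) →ₗ[ℝ] (Fin i → ℝ) :=
    LinearMap.pi fun a => (innerₛₗ ℝ (h a)).comp (Fintype.linearCombination ℝ e)
  have hf : LinearMap.ker f ≠ ⊥ := LinearMap.ker_ne_bot_of_finrank_lt (by simp)
  obtain ⟨t, ht, ht0⟩ := (Submodule.ne_bot_iff _).1 hf
  refine ⟨t, ht0, fun a => ?_⟩
  have := congrFun (LinearMap.mem_ker.1 ht) a
  simpa [f, Fintype.linearCombination_apply] using this

variable {ι : Type*} [Fintype ι] [DecidableEq ι] {e : ι → E} {δ : ℝ}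

/-- The Gram matrix is entrywise `δ`-close to the identity, so the quadratic form loses at most `δ *
(∑ |t j|)² ≤ card ι * δ * ∑ t j²`. -/
lemma half_sum_sq_le_norm_sq (he : ∀ j l, |inner ℝ (e j) (e l) - if j = l then 1 else 0| ≤ δ)
    (hδ : Fintype.card ι * δ ≤ 1 / 2) (t : ι → ℝ) :
    (∑ j, t j ^ 2) / 2 ≤ ‖∑ j, t j • e j‖ ^ 2 := by
  have hexp : ‖∑ j, t j • e j‖ ^ 2 = ∑ j, ∑ l, t j * t l * inner ℝ (e j) (e l) := by
    rw [← real_inner_self_eq_norm_sq, sum_inner]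
    refine Finset.sum_congr rfl fun j _ => ?_
    rw [inner_sum]
    refine Finset.sum_congr rfl fun l _ => ?_
    rw [real_inner_smul_left, real_inner_smul_right]; ring
  have hdiag : ∑ j, t j ^ 2 = ∑ j, ∑ l, t j * t l * (if j = l then 1 else 0) := by
    simp [sq]
  have hdiff : ∑ j, t j ^ 2 - ‖∑ j, t j • e j‖ ^ 2 ≤ δ * (∑ j, |t j|) ^ 2 := by
    rw [hexp, hdiag, ← Finset.sum_sub_distrib, sq, Finset.sum_mul_sum, Finset.mul_sum]
    refine Finset.sum_le_sum fun j _ => ?_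
    rw [← Finset.sum_sub_distrib, Finset.mul_sum]
    refine Finset.sum_le_sum fun l _ => ?_
    rw [← mul_sub, ← abs_mul, mul_comm δ]
    refine (le_abs_self _).trans ?_
    rw [abs_mul, abs_sub_comm]
    exact mul_le_mul_of_nonneg_left (he j l) (abs_nonneg _)
  have hcs : (∑ j, |t j|) ^ 2 ≤ Fintype.card ι * ∑ j, t j ^ 2 := by
    simpa using sq_sum_le_card_mul_sum_sq (s := Finset.univ) (f := fun j => |t j|)
  have hpos : 0 ≤ ∑ j, t j ^ 2 := Finset.sum_nonneg fun j _ => sq_nonneg _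
  rcases isEmpty_or_nonempty ι with hι | ⟨⟨j⟩⟩
  · simp
  have hδ0 : 0 ≤ δ := (abs_nonneg _).trans (he j j)
  have h1 := mul_le_mul_of_nonneg_left hcs hδ0
  have h2 := mul_le_mul_of_nonneg_right hδ hpos
  nlinarith

/-- A lower frame bound on the span: Cauchy–Schwarz in `‖u‖² = ∑ t l * ⟨e l, u⟩`, followed by the
bound on `∑ t j²`. -/
lemma half_norm_sq_le_sum_inner_sq
    (he : ∀ j l, |inner ℝ (e j) (e l) - if j = l then 1 else 0| ≤ δ)
    (hδ : Fintype.card ι * δ ≤ 1 / 2) (t : ι → ℝ) :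
    ‖∑ j, t j • e j‖ ^ 2 / 2 ≤ ∑ l, inner ℝ (e l) (∑ j, t j • e j) ^ 2 := by
  have h1 := half_sum_sq_le_norm_sq he hδ t
  set u := ∑ j, t j • e j with hu
  have h2 : ‖u‖ ^ 2 = ∑ l, t l * inner ℝ (e l) u := by
    rw [← real_inner_self_eq_norm_sq]
    conv_lhs => rw [hu, sum_inner, ← hu]
    simp [real_inner_smul_left]
  have h3 : (‖u‖ ^ 2) ^ 2 ≤ (∑ j, t j ^ 2) * ∑ l, inner ℝ (e l) u ^ 2 := by
    conv_lhs => rw [h2]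
    exact Finset.sum_mul_sq_le_sq_mul_sq _ _ _
  have h4 : 0 ≤ ∑ l, inner ℝ (e l) u ^ 2 := Finset.sum_nonneg fun j _ => sq_nonneg _
  rcases (sq_nonneg ‖u‖).eq_or_lt with h0 | h0
  · rw [← h0]; simpa using h4
  · have h5 := mul_le_mul_of_nonneg_right h1 h4
    nlinarith

end NearlyOrthonormal

/-! ### Lower bound for the leading eigenvalues of the mixture -/

section LowerBound

variable {k d : ℕ} {ε : Fin k → ℝ} {pop : Fin k → Measure (EuclideanSpace ℝ (Fin d))}

/-- The mixture variance along `u` dominates each class's between-class term; the factor 4 comes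
from `(w i - w j)² ≤ 2 * w i² + 2 * w j²`. -/
lemma inner_meanDiff_sq_le (hε : ∀ m, 0 ≤ ε m) (hsum : ∑ m, ε m = 1)
    [∀ m, IsProbabilityMeasure (pop m)] (hpop : ∀ m, MemLp (fun x => x) 2 (pop m))
    {ε₀ : ℝ} (hε₀ : 0 ≤ ε₀) (hle : ∀ m, ε₀ ≤ ε m) (u : EuclideanSpace ℝ (Fin d)) (i j : Fin k) :
    ε₀ * inner ℝ u (meanDiff pop i j) ^ 2
      ≤ 4 * (u.ofLp ⬝ᵥ (covMatrix (mixture ε pop)).mulVec u.ofLp) := by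
  have := isProbabilityMeasure_mixture (pop := pop) hε hsum
  set w : Fin k → ℝ := fun m => inner ℝ u (mean (pop m) - mean (mixture ε pop)) with hw
  have hV : ∀ m, ε₀ * w m ^ 2 ≤ u.ofLp ⬝ᵥ (covMatrix (mixture ε pop)).mulVec u.ofLp := by
    intro m
    rw [dotProduct_covMatrix_mulVec (memLp_mixture hpop), covariance_mixture hε hsum hpop]
    calc ε₀ * w m ^ 2 ≤ ε m * w m ^ 2 := mul_le_mul_of_nonneg_right (hle m) (sq_nonneg _)
      _ ≤ ε m * (cov[fun x => inner ℝ u x, fun x => inner ℝ u x; pop m] + w m * w m) := by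
        rw [covariance_self (memLp_inner (hpop m) u).aemeasurable]
        have := variance_nonneg (fun x => inner ℝ u x) (pop m)
        exact mul_le_mul_of_nonneg_left (by nlinarith) (hε m)
      _ ≤ _ := by
        refine Finset.single_le_sum (f := fun m => ε m *
          (cov[fun x => inner ℝ u x, fun x => inner ℝ u x; pop m] + w m * w m))
          (fun m _ => mul_nonneg (hε m) (add_nonneg ?_ (mul_self_nonneg _))) (Finset.mem_univ m)
        rw [covariance_self (memLp_inner (hpop m) u).aemeasurable]
        exact variance_nonneg _ _
  have hdiff : inner ℝ u (meanDiff pop i j) = w i - w j := by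
    rw [hw, ← inner_sub_right, meanDiff, sub_sub_sub_cancel_right]
  have hi := hV i
  have hj := hV j
  have : (w i - w j) ^ 2 ≤ 2 * w i ^ 2 + 2 * w j ^ 2 := by nlinarith [sq_nonneg (w i + w j)]
  have := mul_le_mul_of_nonneg_left this hε₀
  rw [hdiff]
  linarith

lemma mul_gap_le_eigenvalue (hε : ∀ m, 0 ≤ ε m) (hsum : ∑ m, ε m = 1)
    [∀ m, IsProbabilityMeasure (pop m)] (hpop : ∀ m, MemLp (fun x => x) 2 (pop m))
    {ε₀ : ℝ} (hε₀ : 0 ≤ ε₀) (hle : ∀ m, ε₀ ≤ ε m) {lam : ℕ → ℝ}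
    {h : ℕ → EuclideanSpace ℝ (Fin d)}
    (hdec : IsEigenDecomposition (covMatrix (mixture ε pop)) lam h) {i : ℕ} (hid : i < d)
    (p q : Fin (i + 1) → Fin k) {g δ : ℝ} (hδ : (i + 1) * δ ≤ 1 / 2) (hδ0 : 0 ≤ δ)
    (hg0 : 0 ≤ g) (hne : ∀ j, 0 < gap pop (p j) (q j)) (hg : ∀ j, g ≤ gap pop (p j) (q j))
    (hcos : ∀ j l, j ≠ l → |Real.cos (InnerProductGeometry.angle (meanDiff pop (p j) (q j))
      (meanDiff pop (p l) (q l)))| ≤ δ) :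
    ε₀ * g ≤ 8 * (i + 1) * lam i := by
  set v : Fin (i + 1) → EuclideanSpace ℝ (Fin d) := fun j => meanDiff pop (p j) (q j) with hv
  have hvpos : ∀ j, 0 < ‖v j‖ := fun j => by
    have : 0 < ‖v j‖ ^ 2 := hne j
    exact (norm_nonneg _).lt_of_ne fun h0 => by simp [← h0] at this
  set e : Fin (i + 1) → EuclideanSpace ℝ (Fin d) := fun j => ‖v j‖⁻¹ • v j with he
  have hve : ∀ j, v j = ‖v j‖ • e j := fun j => by
    rw [he, smul_smul, mul_inv_cancel₀ (hvpos j).ne', one_smul]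
  have horth : ∀ j l, |inner ℝ (e j) (e l) - if j = l then 1 else 0| ≤ δ := by
    intro j l
    have hinner : inner ℝ (e j) (e l) = Real.cos (InnerProductGeometry.angle (v j) (v l)) := by
      rw [InnerProductGeometry.cos_angle, he, real_inner_smul_left, real_inner_smul_right]
      field_simp
    rw [hinner]
    split_ifs with hjl
    · subst hjl
      rw [InnerProductGeometry.angle_self (norm_pos_iff.1 (hvpos j))]
      simpa using hδ0
    · simpa using hcos j l hjl
  have hcard : (Fintype.card (Fin (i + 1)) : ℝ) * δ ≤ 1 / 2 := by simpa using hδ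
  obtain ⟨t, ht0, ht⟩ := exists_combination_orthogonal (fun a : Fin i => h a) e
  have hlow := half_sum_sq_le_norm_sq horth hcard t
  have hsumsq := half_norm_sq_le_sum_inner_sq horth hcard t
  set u := ∑ j, t j • e j
  -- Near-orthonormality makes the `e j` independent, so `t ≠ 0` forces `u ≠ 0`.
  have hupos : 0 < ‖u‖ ^ 2 := by
    obtain ⟨j, hj⟩ := Function.ne_iff.1 ht0
    have : 0 < ∑ j, t j ^ 2 :=
      Finset.sum_pos' (fun j _ => sq_nonneg _)
        ⟨j, Finset.mem_univ j, sq_pos_of_ne_zero hj⟩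
    linarith
  have hray := hdec.dotProduct_mulVec_le hid fun a ha => ht ⟨a, ha⟩
  have hterm : ∀ j, ε₀ * g * inner ℝ (e j) u ^ 2 ≤ 4 * (lam i * ‖u‖ ^ 2) := fun j => by
    have h1 := inner_meanDiff_sq_le hε hsum hpop hε₀ hle u (p j) (q j)
    have h2 : inner ℝ u (meanDiff pop (p j) (q j)) ^ 2
        = gap pop (p j) (q j) * inner ℝ (e j) u ^ 2 := by
      have : meanDiff pop (p j) (q j) = ‖v j‖ • e j := hve j
      rw [this, real_inner_smul_right, mul_pow, real_inner_comm]
      rfl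
    have h3 : ε₀ * g * inner ℝ (e j) u ^ 2 ≤ ε₀ * gap pop (p j) (q j) * inner ℝ (e j) u ^ 2 :=
      mul_le_mul_of_nonneg_right (mul_le_mul_of_nonneg_left (hg j) hε₀) (sq_nonneg _)
    rw [h2] at h1
    linarith
  have htotal : ε₀ * g * ∑ j, inner ℝ (e j) u ^ 2 ≤ (i + 1) * (4 * (lam i * ‖u‖ ^ 2)) := by
    rw [Finset.mul_sum]
    refine (Finset.sum_le_sum fun j _ => hterm j).trans ?_
    simp
  have h1 := mul_le_mul_of_nonneg_left hsumsq (mul_nonneg hε₀ hg0)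
  -- The constant 8 is 4 from the variance bound times 2 from the frame bound.
  have h2 : ε₀ * g * ‖u‖ ^ 2 ≤ 8 * (i + 1) * lam i * ‖u‖ ^ 2 := by linarith
  exact le_of_mul_le_mul_right h2 hupos

end LowerBound

/-! ### Asymptotics -/

lemma gapMin_le_gap {k d : ℕ} (pop : Fin k → Measure (EuclideanSpace ℝ (Fin d))) {i j : Fin k}
    (hij : i < j) : gapMin pop ≤ gap pop i j :=
  ciInf_le (f := fun p : {p : Fin k × Fin k // p.1 < p.2} => gap pop p.1.1 p.1.2)
    (Set.finite_range _).bddBelow ⟨(i, j), hij⟩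

lemma variance_inner_le_iSup {k d : ℕ} {pop : Fin k → Measure (EuclideanSpace ℝ (Fin d))}
    [∀ m, IsProbabilityMeasure (pop m)] (hpop : ∀ m, MemLp (fun x => x) 2 (pop m))
    {u : EuclideanSpace ℝ (Fin d)} (hu : ‖u‖ = 1) (m : Fin k) :
    Var[fun x => inner ℝ u x; pop m] ≤ ⨆ i, largestEigenvalue (covMatrix (pop i)) := by
  have h1 := variance_inner_le (hpop m) u
  rw [hu, one_pow, mul_one] at h1
  exact h1.trans (le_ciSup (f := fun i => largestEigenvalue (covMatrix (pop i)))
    (Set.finite_range _).bddAbove m)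

/-- Eigenvectors diagonalize the mixture covariance, and its between-class part, once normalized, is
the Gram matrix of the rows. The error is therefore the averaged within-class covariance. -/
lemma abs_gram_sub_le {k d : ℕ} {ε : Fin k → ℝ}
    {pop : Fin k → Measure (EuclideanSpace ℝ (Fin d))} (hε : ∀ m, 0 ≤ ε m) (hsum : ∑ m, ε m = 1)
    [∀ m, IsProbabilityMeasure (pop m)] (hpop : ∀ m, MemLp (fun x => x) 2 (pop m)) {lam : ℕ → ℝ}
    {h : ℕ → EuclideanSpace ℝ (Fin d)}
    (hdec : IsEigenDecomposition (covMatrix (mixture ε pop)) lam h) {i j : ℕ} (hi : i < d)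
    (hj : j < d) (hlami : 0 < lam i) (hlamj : 0 < lam j) {N : ℝ}
    (hNi : ∀ m, Var[fun x => inner ℝ (h i) x; pop m] ≤ N)
    (hNj : ∀ m, Var[fun x => inner ℝ (h j) x; pop m] ≤ N) :
    |∑ m, ε m * (inner ℝ (h i) (mean (pop m) - mean (mixture ε pop)) / √(lam i)
        * (inner ℝ (h j) (mean (pop m) - mean (mixture ε pop)) / √(lam j)))
      - if i = j then 1 else 0| ≤ N / lam i + N / lam j := by
  have := isProbabilityMeasure_mixture (pop := pop) hε hsum
  have hsi := Real.sqrt_pos.2 hlami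
  have hsj := Real.sqrt_pos.2 hlamj
  have hcov := covariance_mixture hε hsum hpop (h i) (h j)
  rw [← dotProduct_covMatrix_mulVec (memLp_mixture hpop), hdec.dotProduct_mulVec hi hj] at hcov
  have hone : (if i = j then 1 else 0 : ℝ)
      = (if i = j then lam i else 0) / (√(lam i) * √(lam j)) := by
    split_ifs with hij
    · subst hij
      rw [Real.mul_self_sqrt hlami.le, div_self hlami.ne']
    · rw [zero_div]
  have hnoise : ∀ m, |cov[fun x => inner ℝ (h i) x, fun x => inner ℝ (h j) x; pop m]
      / (√(lam i) * √(lam j))| ≤ N / lam i + N / lam j := by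
    intro m
    -- Scaling first splits the bound into the two ratios `N / lam i` and `N / lam j`.
    have h1 := abs_covariance_le_add ((memLp_inner (hpop m) (h i)).const_mul (√(lam i))⁻¹)
      ((memLp_inner (hpop m) (h j)).const_mul (√(lam j))⁻¹)
    rw [covariance_const_mul_left, covariance_const_mul_right, variance_const_mul,
      variance_const_mul, inv_pow, inv_pow, Real.sq_sqrt hlami.le, Real.sq_sqrt hlamj.le,
      inv_mul_eq_div, inv_mul_eq_div, inv_mul_eq_div, inv_mul_eq_div, div_div, mul_comm (√(lam j))]
      at h1
    exact h1.trans (add_le_add (div_le_div_of_nonneg_right (hNi m) hlami.le)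
      (div_le_div_of_nonneg_right (hNj m) hlamj.le))
  rw [hone, hcov, Finset.sum_div, ← Finset.sum_sub_distrib]
  calc _ = |∑ m, ε m * -(cov[fun x => inner ℝ (h i) x, fun x => inner ℝ (h j) x; pop m]
        / (√(lam i) * √(lam j)))| := by
        congr 1
        refine Finset.sum_congr rfl fun m _ => ?_
        field_simp
        ring
    _ ≤ ∑ m, ε m * (N / lam i + N / lam j) := by
        refine (Finset.abs_sum_le_sum_abs _ _).trans (Finset.sum_le_sum fun m _ => ?_)
        rw [abs_mul, abs_of_nonneg (hε m), abs_neg]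
        exact mul_le_mul_of_nonneg_left (hnoise m) (hε m)
    _ = _ := by rw [← Finset.sum_mul, hsum, one_mul]

section Asymptotics

variable {k : ℕ} {ε : Fin k → ℝ} {pop : (d : ℕ) → Fin k → Measure (EuclideanSpace ℝ (Fin d))}
  {lam : ℕ → ℕ → ℝ} {h : (d : ℕ) → ℕ → EuclideanSpace ℝ (Fin d)}

lemma NoiseCondition.eventually_gap_pos (hnoise : NoiseCondition pop) {i j : Fin k}
    (hij : i < j) : ∀ᶠ d in atTop, 0 < gap (pop d) i j := by
  filter_upwards [hnoise.1] with d hd using hd.trans_le (gapMin_le_gap _ hij)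

lemma SeparationCondition.eventually_gap_le (hsep : SeparationCondition pop)
    (hnoise : NoiseCondition pop) {i j : ℕ} (hj : j + 1 < k) (hij : i ≤ j) :
    ∀ᶠ d in atTop, gap (pop d) ⟨j, Nat.lt_of_succ_lt hj⟩ ⟨j + 1, hj⟩
      ≤ gap (pop d) ⟨i, by omega⟩ ⟨i + 1, by omega⟩ := by
  rcases hij.eq_or_lt with rfl | hij
  · exact Eventually.of_forall fun d => le_rfl
  have hpos := hnoise.eventually_gap_pos (i := ⟨i, by omega⟩) (j := ⟨i + 1, by omega⟩)
    (by simp [Fin.lt_def])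
  filter_upwards [hpos, (hsep i j (by omega) hj hij).2.eventually (gt_mem_nhds one_pos)]
    with d h1 h2
  exact ((div_lt_one h1).1 h2).le

lemma SeparationCondition.eventually_abs_cos_le (hsep : SeparationCondition pop) {i j : ℕ}
    (hi : i + 1 < k) (hj : j + 1 < k) (hij : i ≠ j) {δ : ℝ} (hδ : 0 < δ) :
    ∀ᶠ d in atTop, |Real.cos (InnerProductGeometry.angle
      (meanDiff (pop d) ⟨i, Nat.lt_of_succ_lt hi⟩ ⟨i + 1, hi⟩)
      (meanDiff (pop d) ⟨j, Nat.lt_of_succ_lt hj⟩ ⟨j + 1, hj⟩))| ≤ δ := by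
  wlog hlt : i < j generalizing i j
  · have := this hj hi hij.symm (by omega)
    simpa only [InnerProductGeometry.angle_comm] using this
  have h1 := ((Real.continuous_cos.tendsto _).comp (hsep i j hi hj hlt).1).abs
  rw [Real.cos_pi_div_two, abs_zero] at h1
  exact h1.eventually (ge_mem_nhds hδ)

lemma exists_pos_forall_le {k : ℕ} {ε : Fin k → ℝ} (hε : ∀ m, 0 < ε m) :
    ∃ ε₀ > 0, ∀ m, ε₀ ≤ ε m := by
  rcases isEmpty_or_nonempty (Fin k) with hk | hk
  · exact ⟨1, one_pos, fun m => isEmptyElim m⟩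
  · obtain ⟨m, hm⟩ := Finite.exists_min ε
    exact ⟨ε m, hε m, hm⟩

lemma eventually_gap_le_eigenvalue (hε : ∀ m, 0 < ε m) (hsum : ∑ m, ε m = 1)
    [∀ d m, IsProbabilityMeasure (pop d m)] (hpop : ∀ d m, MemLp (fun x => x) 2 (pop d m))
    (heig : ∀ d, IsEigenDecomposition (covMatrix (mixture ε (pop d))) (lam d) (h d))
    (hnoise : NoiseCondition pop) (hsep : SeparationCondition pop) (i : ℕ) (hi : i + 1 < k) :
    ∃ c > 0, ∀ᶠ d in atTop,
      c * gap (pop d) ⟨i, Nat.lt_of_succ_lt hi⟩ ⟨i + 1, hi⟩ ≤ lam d i := by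
  obtain ⟨ε₀, hε₀, hle⟩ := exists_pos_forall_le hε
  refine ⟨ε₀ / (8 * (i + 1)), by positivity, ?_⟩
  have hδ : (0 : ℝ) < 1 / (2 * (i + 1)) := by positivity
  let p : Fin (i + 1) → Fin k := fun j => ⟨j, by omega⟩
  let q : Fin (i + 1) → Fin k := fun j => ⟨j + 1, by omega⟩
  have hpq : ∀ j, p j < q j := fun j => by simp [p, q, Fin.lt_def]
  have h1 : ∀ᶠ d in atTop, ∀ j, 0 < gap (pop d) (p j) (q j) :=
    eventually_all.2 fun j => hnoise.eventually_gap_pos (hpq j)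
  -- Earlier gaps dominate, so gap `i` is a common lower bound for all `i + 1` directions.
  have h2 : ∀ᶠ d in atTop, ∀ j, gap (pop d) ⟨i, Nat.lt_of_succ_lt hi⟩ ⟨i + 1, hi⟩
      ≤ gap (pop d) (p j) (q j) :=
    eventually_all.2 fun j => hsep.eventually_gap_le hnoise hi (by omega)
  have h3 : ∀ᶠ d in atTop, ∀ j l, j ≠ l → |Real.cos (InnerProductGeometry.angle
      (meanDiff (pop d) (p j) (q j)) (meanDiff (pop d) (p l) (q l)))| ≤ 1 / (2 * ((i : ℝ) + 1)) := by
    refine eventually_all.2 fun j => eventually_all.2 fun l => ?_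
    by_cases hjl : j = l
    · exact Eventually.of_forall fun d hne => absurd hjl hne
    · filter_upwards [hsep.eventually_abs_cos_le (i := j) (j := l) (by omega) (by omega)
        (fun hv => hjl (Fin.ext hv)) hδ] with d hd _ using hd
  filter_upwards [h1, h2, h3, eventually_gt_atTop i] with d h1 h2 h3 hd
  have := mul_gap_le_eigenvalue (fun m => (hε m).le) hsum (hpop d) hε₀.le hle (heig d) hd p q
    (g := gap (pop d) ⟨i, Nat.lt_of_succ_lt hi⟩ ⟨i + 1, hi⟩)
    (by field_simp; exact le_rfl) hδ.le (sq_nonneg _) h1 h2 h3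
  rw [div_mul_eq_mul_div, div_le_iff₀ (by positivity)]
  linarith

lemma NoiseCondition.tendsto_iSup_div (hnoise : NoiseCondition pop) {i j : Fin k} (hij : i < j)
    {c : ℝ} (hc : 0 < c) {f : ℕ → ℝ} (hf : ∀ᶠ d in atTop, c * gap (pop d) i j ≤ f d)
    (hnonneg : ∀ᶠ d in atTop, 0 ≤ ⨆ i, largestEigenvalue (covMatrix (pop d i))) :
    Tendsto (fun d => (⨆ i, largestEigenvalue (covMatrix (pop d i))) / f d) atTop (𝓝 0) := by
  have hup := hnoise.2.const_mul c⁻¹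
  rw [mul_zero] at hup
  refine tendsto_of_tendsto_of_tendsto_of_le_of_le' tendsto_const_nhds hup ?_ ?_
  · filter_upwards [hf, hnonneg, hnoise.eventually_gap_pos hij] with d h1 h2 h3
    have := (mul_pos hc h3).trans_le h1
    positivity
  · filter_upwards [hf, hnonneg, hnoise.1] with d h1 h2 h3
    have h4 : c * gapMin (pop d) ≤ f d :=
      (mul_le_mul_of_nonneg_left (gapMin_le_gap _ hij) hc.le).trans h1
    calc _ ≤ (⨆ i, largestEigenvalue (covMatrix (pop d i))) / (c * gapMin (pop d)) :=
          div_le_div_of_nonneg_left h2 (mul_pos hc h3) h4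
      _ = _ := by field_simp

end Asymptotics

end MixturePCA

open MixturePCA

theorem theorem2 {Ω : Type*} [MeasurableSpace Ω] (P : Measure Ω) [IsProbabilityMeasure P]
    (k n : ℕ) (hk : 2 ≤ k)
    -- the mixing proportions, which do not depend on `d`
    (ε : Fin k → ℝ) (hε : ∀ m, ε m ∈ Set.Ioo (0 : ℝ) 1) (hε_sum : ∑ m, ε m = 1)
    -- the `k` populations in each dimension `d`, with finite second moments
    (pop : (d : ℕ) → Fin k → Measure (EuclideanSpace ℝ (Fin d)))
    [∀ d m, IsProbabilityMeasure (pop d m)]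
    (hpop : ∀ d m, MemLp (fun x => x) 2 (pop d m))
    -- the sample; the latent class labels do not depend on `d`
    (label : Fin n → Ω → Fin k)
    (x : (d : ℕ) → Fin n → Ω → EuclideanSpace ℝ (Fin d))
    (hx : ∀ d, MixturePCA.IsMixtureSample P ε (pop d) label (x d))
    -- an eigen-decomposition of the covariance matrix of the mixture
    (lam : ℕ → ℕ → ℝ) (h : (d : ℕ) → ℕ → EuclideanSpace ℝ (Fin d))
    (heig : ∀ d, MixturePCA.IsEigenDecomposition
      (MixturePCA.covMatrix (MixturePCA.mixture ε (pop d))) (lam d) (h d))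
    -- the choice of the signs of the first `k - 1` eigenvectors
    (hsign : ∀ (d i : ℕ) (hi : i + 1 < k), i < d →
      0 ≤ inner ℝ (h d i)
        (MixturePCA.meanDiff (pop d) ⟨i, Nat.lt_of_succ_lt hi⟩ ⟨i + 1, hi⟩))
    (hnoise : MixturePCA.NoiseCondition pop)
    (hsep : MixturePCA.SeparationCondition pop) :
    -- convergence in probability of the normalized score of index `i`, given that `x j` is in class `m`
    ∀ i : Fin k, (i : ℕ) + 1 < k → ∀ (j : Fin n) (m : Fin k),
      TendstoInMeasure (cond P (label j ⁻¹' {m}))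
        (fun d ω =>
          inner ℝ (h d i) (x d j ω - MixturePCA.mean (MixturePCA.mixture ε (pop d))) / √(lam d i))
        atTop (fun _ => MixturePCA.scoreLimit ε i m) := by
  have hε0 : ∀ m, 0 < ε m := fun m => (hε m).1
  have hε0' : ∀ m, 0 ≤ ε m := fun m => (hε0 m).le
  have hgap := eventually_gap_le_eigenvalue hε0 hε_sum hpop heig hnoise hsep
  choose c hc hlam using hgap
  have hlt : ∀ (i : ℕ) (hi : i + 1 < k),
      (⟨i, Nat.lt_of_succ_lt hi⟩ : Fin k) < ⟨i + 1, hi⟩ := fun i hi => by simp [Fin.lt_def]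
  have hlampos : ∀ i, i + 1 < k → ∀ᶠ d in atTop, 0 < lam d i := fun i hi => by
    filter_upwards [hlam i hi, hnoise.eventually_gap_pos (hlt i hi)] with d h1 h2
    exact (mul_pos (hc i hi) h2).trans_le h1
  have hvar : ∀ {d i : ℕ}, i < d → ∀ m, Var[fun x => inner ℝ (h d i) x; pop d m]
      ≤ ⨆ i, largestEigenvalue (covMatrix (pop d i)) := fun {d i} hid m =>
    variance_inner_le_iSup (hpop d) ((heig d).norm_eq_one hid) m
  have hnonneg : ∀ᶠ d in atTop, 0 ≤ ⨆ i, largestEigenvalue (covMatrix (pop d i)) := by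
    filter_upwards [eventually_gt_atTop 0] with d hd
    exact (variance_nonneg _ _).trans (hvar hd ⟨0, by omega⟩)
  have hnoise0 : ∀ i, i + 1 < k → Tendsto (fun d =>
      (⨆ i, largestEigenvalue (covMatrix (pop d i))) / lam d i) atTop (𝓝 0) := fun i hi =>
    hnoise.tendsto_iSup_div (hlt i hi) (hc i hi) (hlam i hi) hnonneg
  set a : ℕ → Fin k → Fin k → ℝ := fun d i m =>
    inner ℝ (h d i) (mean (pop d m) - mean (mixture ε (pop d))) / √(lam d i) with ha
  have hadiff : ∀ (d : ℕ) (i m m' : Fin k),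
      a d i m - a d i m' = inner ℝ (h d i) (meanDiff (pop d) m m') / √(lam d i) := by
    intro d i m m'
    rw [ha, ← sub_div, ← inner_sub_right, meanDiff, sub_sub_sub_cancel_right]
  have hmeans : ∀ i : Fin k, (i : ℕ) + 1 < k → ∀ m,
      Tendsto (fun d => a d i m) atTop (𝓝 (scoreLimit ε i m)) := by
    refine tendsto_scoreLimit_of_gram hε0 hε_sum ?_ ?_ ?_ ?_
    · intro d i
      have := sum_mul_inner_mean_sub hε0' hε_sum (hpop d) (h d i)
      simp only [ha, ← mul_div_assoc, ← Finset.sum_div, this, zero_div]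
    · intro i j hi hj
      have hbound : Tendsto (fun d => (⨆ i, largestEigenvalue (covMatrix (pop d i))) / lam d i
          + (⨆ i, largestEigenvalue (covMatrix (pop d i))) / lam d j) atTop (𝓝 0) := by
        simpa using (hnoise0 i hi).add (hnoise0 j hj)
      have herr : Tendsto (fun d => (∑ m, ε m * (a d i m * a d j m)) - if i = j then 1 else 0)
          atTop (𝓝 0) := by
        refine squeeze_zero_norm' ?_ hbound
        filter_upwards [hlampos i hi, hlampos j hj, eventually_gt_atTop (i : ℕ),
          eventually_gt_atTop (j : ℕ)] with d hpi hpj hid hjd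
        have := abs_gram_sub_le hε0' hε_sum (hpop d) (heig d) hid hjd hpi hpj (hvar hid) (hvar hjd)
        simpa only [Fin.val_inj, ha, Real.norm_eq_abs] using this
      simpa using herr.add_const (if i = j then (1 : ℝ) else 0)
    · intro i m hm him
      have hi : (i : ℕ) + 1 < k := by omega
      have hratio := ((hsep i m hi hm him).2.const_mul (c i hi)⁻¹).sqrt
      rw [mul_zero, Real.sqrt_zero] at hratio
      refine squeeze_zero_norm' ?_ hratio
      filter_upwards [hlam i hi, hnoise.eventually_gap_pos (hlt i hi), eventually_gt_atTop (i : ℕ)]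
        with d h1 h2 h3
      have hci := mul_pos (hc i hi) h2
      rw [hadiff, norm_div, Real.norm_eq_abs (√_), abs_of_nonneg (Real.sqrt_nonneg _)]
      -- As `h d i` is a unit vector, the difference is at most the root of gap `m` over `c` times
      -- gap `i`, which vanishes because `i < m`.
      have hcs : ‖inner ℝ (h d i) (meanDiff (pop d) ⟨m, Nat.lt_of_succ_lt hm⟩ ⟨m + 1, hm⟩)‖
          ≤ √(gap (pop d) ⟨m, Nat.lt_of_succ_lt hm⟩ ⟨m + 1, hm⟩) := by
        rw [gap, Real.sqrt_sq (norm_nonneg _)]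
        refine (norm_inner_le_norm _ _).trans ?_
        rw [(heig d).norm_eq_one h3, one_mul]
      calc _ ≤ √(gap (pop d) ⟨m, Nat.lt_of_succ_lt hm⟩ ⟨m + 1, hm⟩)
            / √(c i hi * gap (pop d) ⟨i, Nat.lt_of_succ_lt hi⟩ ⟨i + 1, hi⟩) :=
            div_le_div₀ (Real.sqrt_nonneg _) hcs (Real.sqrt_pos.2 hci) (Real.sqrt_le_sqrt h1)
        _ = _ := by
          rw [← Real.sqrt_div (show 0 ≤ gap (pop d) _ _ from sq_nonneg _), div_mul_eq_div_div_swap,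
            inv_mul_eq_div]
    · intro i hi
      filter_upwards [eventually_gt_atTop i] with d hd
      rw [← sub_nonneg, hadiff]
      exact div_nonneg (hsign d i hi hd) (Real.sqrt_nonneg _)
  intro i hi j m
  rw [tendstoInMeasure_iff_norm]
  intro δ hδ
  have hcheb : Tendsto (fun d => ENNReal.ofReal
      (((⨆ i, largestEigenvalue (covMatrix (pop d i))) / lam d i) / (δ / 2) ^ 2)) atTop (𝓝 0) := by
    simpa using ENNReal.tendsto_ofReal ((hnoise0 i hi).div_const ((δ / 2) ^ 2))
  refine tendsto_of_tendsto_of_tendsto_of_le_of_le' tendsto_const_nhds hcheb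
    (Eventually.of_forall fun _ => zero_le) ?_
  -- The tolerance is halved: one half for the deviation of `a d i m` from its limit, one for the
  -- random fluctuation.
  have hclose := (Metric.tendsto_nhds.1 (hmeans i hi m)) (δ / 2) (half_pos hδ)
  filter_upwards [hclose, hlampos i hi, eventually_gt_atTop (i : ℕ)] with d h1 h2 h3
  set F : EuclideanSpace ℝ (Fin d) → ℝ := fun y =>
    (√(lam d i))⁻¹ * inner ℝ (h d i) y with hF
  have hFm : MemLp F 2 (pop d m) := (memLp_inner (hpop d m) (h d i)).const_mul _
  have hmeasx : Measurable (x d j) := (hx d).measurable_sample j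
  have hFmean : ∀ y, inner ℝ (h d i) (y - mean (mixture ε (pop d))) / √(lam d i) - a d i m
      = F y - ∫ z, F z ∂(pop d m) := by
    intro y
    rw [hF, integral_const_mul, ← inner_mean (hpop d m)]
    simp only [ha, inner_sub_right]
    ring
  have hFvar : Var[F; pop d m] ≤ (⨆ i, largestEigenvalue (covMatrix (pop d i))) / lam d i := by
    rw [hF, variance_const_mul, inv_pow, Real.sq_sqrt h2.le, inv_mul_eq_div]
    exact div_le_div_of_nonneg_right (hvar h3 m) h2.le
  have hmeas : MeasurableSet {y : EuclideanSpace ℝ (Fin d) | δ / 2 ≤ |F y - ∫ z, F z ∂(pop d m)|} :=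
    measurableSet_le measurable_const (by fun_prop)
  calc _ ≤ (cond P (label j ⁻¹' {m})) (x d j ⁻¹' {y | δ / 2 ≤ |F y - ∫ z, F z ∂(pop d m)|}) := by
        refine measure_mono fun ω hω => ?_
        simp only [Set.mem_ofPred_eq, Set.mem_preimage] at hω ⊢
        rw [← hFmean]
        rw [Real.dist_eq] at h1
        rw [Real.norm_eq_abs] at hω
        have := abs_sub_le (inner ℝ (h d i) (x d j ω - mean (mixture ε (pop d))) / √(lam d i))
          (a d i m) (scoreLimit ε i m)
        linarith
    _ = (pop d m) {y | δ / 2 ≤ |F y - ∫ z, F z ∂(pop d m)|} := by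
        rw [← Measure.map_apply hmeasx hmeas, (hx d).law_sample j m]
    _ ≤ ENNReal.ofReal (Var[F; pop d m] / (δ / 2) ^ 2) := meas_ge_le_variance_div_sq hFm (half_pos hδ)
    _ ≤ _ := ENNReal.ofReal_le_ofReal (div_le_div_of_nonneg_right hFvar (by positivity))
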